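/- **Conventions.** A *signature* $\Sigma$ is a (small) many-sorted signature of operation and relation symbols; $\mathbf{Str}\,\Sigma$ is the category of $\Sigma$-structures and homomorphisms (maps preserving sorts, operations and relations). For a regular cardinal $\kappa$, $L_{\kappa\kappa}$ is the infinitary first-order logic over $\Sigma$ with conjunctions of fewer than $\kappa$ formulas and quantification over fewer than $\kappa$ variables. A monomorphism $m:M\to N$ of $\mathbf{Str}\,\Sigma$ is a *$\kappa$-elementary embedding* if for every formula $\varphi(x_i)$ of $L_{\kappa\kappa}$ and every interpretation $p$ of its free variables in $M$, $M$ satisfies $\varphi(p(x_i))$ if and only if $N$ satisfies $\varphi(m(p(x_i)))$. Let $\mathcal K$ be a subcategory, not necessarily full, of a category $\mathcal L$. It is *reflective* if the inclusion $\mathcal K\hookrightarrow\mathcal L$ has a left adjoint. It is *closed under limits* (resp. *under $\lambda$-filtered colimits*) if $\mathcal K$ has all small limits (resp. all small $\lambda$-filtered colimits) and the inclusion preserves them. It is *closed under $\kappa$-elementary embeddings* if there are a signature $\Sigma$ and a fully faithful functor $E:\mathcal L\to\mathbf{Str}\,\Sigma$ that has a left adjoint and preserves $\kappa$-filtered colimits,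 such that for every morphism $m:L\to K$ of $\mathcal L$ with $K\in\mathcal K$: if $Em$ is a $\kappa$-elementary embedding, then $L$ and $m$ lie in $\mathcal K$. **Theorem.** Let $\mathcal L$ be a locally presentable category and $\mathcal K$ a subcategory of $\mathcal L$, not necessarily full, that is closed under limits. 1. If, for some regular cardinal $\lambda$, $\mathcal K$ is closed under $\lambda$-filtered colimits and under $\lambda$-elementary embeddings, then $\mathcal K$ is reflective in $\mathcal L$. 2. If $\mathcal L$ is locally $\lambda$-presentable and $\mathcal K$ is closed under $\lambda$-filtered colimits and under $\kappa$-elementary embeddings, for regular cardinals $\lambda\le\kappa$, then $\mathcal K$ is reflective in $\mathcal L$ and $\mathcal K$ is itself locally $\lambda$-presentable. -/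

import Mathlib

open CategoryTheory CategoryTheory.Limits

universe w u

namespace ElemRefl

/-! ### Many-sorted signatures and the category of structures -/

/-- A (small) many-sorted signature: a set of sorts, a set of operation symbols and a set of
relation symbols.  Arities are arbitrary small sets of argument places, each with a sort;
finitary signatures are the special case of finite arities. -/
structure Signature : Type (w + 1) where
  Srt : Type w
  Op : Type w
  OpArity : Op → Type w
  opIn : (o : Op) → OpArity o → Srt
  opOut : Op → Srt
  Rel : Type w
  RelArity : Rel → Type w
  relIn : (r : Rel) → RelArity r → Srt

/-- A `S`-structure: an underlying many-sorted set (components may be empty), with an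
interpretation of every operation symbol and of every relation symbol. -/
structure Str (S : Signature.{w}) : Type (w + 1) where
  carrier : S.Srt → Type w
  op : (o : S.Op) → (∀ i : S.OpArity o, carrier (S.opIn o i)) → carrier (S.opOut o)
  rel : (r : S.Rel) → (∀ i : S.RelArity r, carrier (S.relIn r i)) → Prop

namespace Str

variable {S : Signature.{w}}

/-- Homomorphisms: sort-preserving maps that commute with the operations and preserve
the relations. -/
@[ext]
structure Hom (M N : Str S) : Type w where
  toFun : (s : S.Srt) → M.carrier s → N.carrier s
  map_op : ∀ (o : S.Op) (a : ∀ i : S.OpArity o, M.carrier (S.opIn o i)),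
    toFun (S.opOut o) (M.op o a) = N.op o (fun i => toFun (S.opIn o i) (a i))
  map_rel : ∀ (r : S.Rel) (a : ∀ i : S.RelArity r, M.carrier (S.relIn r i)),
    M.rel r a → N.rel r (fun i => toFun (S.relIn r i) (a i))

instance : Category (Str S) where
  Hom M N := Hom M N
  id M := ⟨fun _ x => x, fun _ _ => rfl, fun _ _ h => h⟩
  comp f g := ⟨fun s x => g.toFun s (f.toFun s x),
    fun o a => by rw [f.map_op, g.map_op], fun r a h => g.map_rel r _ (f.map_rel r a h)⟩

end Str

/-! ### The infinitary logic `L_{κκ}` -/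

/-- Terms of each sort in a context of variables `V`, where the variable `v` has sort `t v`. -/
inductive Term (S : Signature.{w}) {V : Type w} (t : V → S.Srt) : S.Srt → Type w
  | var (v : V) : Term S t (t v)
  | app (o : S.Op) (a : ∀ i : S.OpArity o, Term S t (S.opIn o i)) : Term S t (S.opOut o)

/-- The value of a term in a structure under an interpretation `p` of the variables. -/
def Term.eval {S : Signature.{w}} {V : Type w} {t : V → S.Srt} (M : Str S)
    (p : ∀ v, M.carrier (t v)) : {s : S.Srt} → Term S t s → M.carrier s
  | _, .var v => p v
  | _, .app o a => M.op o (fun i => (a i).eval M p)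

/-- Formulas of `L_{κκ}` with free variables in a sorted context: atomic formulas
(equations and relations), negation, conjunctions of fewer than `κ` formulas, and existential
quantification over a set `W` of fewer than `κ` new variables.  The other connectives and the
universal quantifier are obtained from these by negation. -/
inductive Formula (S : Signature.{w}) (κ : Cardinal.{w}) :
    {V : Type w} → (V → S.Srt) → Type (w + 1)
  | equal {V : Type w} {t : V → S.Srt} {s : S.Srt} (a b : Term S t s) : Formula S κ t
  | rel {V : Type w} {t : V → S.Srt} (r : S.Rel)
      (a : ∀ i : S.RelArity r, Term S t (S.relIn r i)) : Formula S κ t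
  | neg {V : Type w} {t : V → S.Srt} (φ : Formula S κ t) : Formula S κ t
  | conj {V : Type w} {t : V → S.Srt} (I : Type w) (hI : Cardinal.mk I < κ)
      (φ : I → Formula S κ t) : Formula S κ t
  | exist {V : Type w} {t : V → S.Srt} (W : Type w) (hW : Cardinal.mk W < κ) (t' : W → S.Srt)
      (φ : Formula S κ (Sum.elim t t')) : Formula S κ t

/-- Extension of an interpretation of the variables in `V` to the variables in `V ⊕ W`. -/
def extend {S : Signature.{w}} (M : Str S) {V W : Type w} {t : V → S.Srt} {t' : W → S.Srt}
    (p : ∀ v, M.carrier (t v)) (q : ∀ x, M.carrier (t' x)) :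
    ∀ y : V ⊕ W, M.carrier (Sum.elim t t' y)
  | .inl v => p v
  | .inr x => q x

/-- Satisfaction of a formula in a structure under an interpretation of its free variables. -/
def Formula.Sat {S : Signature.{w}} {κ : Cardinal.{w}} (M : Str S) :
    {V : Type w} → {t : V → S.Srt} → Formula S κ t → (∀ v, M.carrier (t v)) → Prop
  | _, _, .equal a b, p => a.eval M p = b.eval M p
  | _, _, .rel r a, p => M.rel r (fun i => (a i).eval M p)
  | _, _, .neg φ, p => ¬ φ.Sat M p
  | _, _, .conj _ _ φ, p => ∀ i, (φ i).Sat M p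
  | _, _, .exist W _ t' φ, p => ∃ q : ∀ x : W, M.carrier (t' x), φ.Sat M (extend M p q)

/-- A monomorphism `m : M ⟶ N` of structures is a `κ`-elementary embedding if, for every formula
of `L_{κκ}` and every interpretation `p` of its free variables in `M`, the formula holds in `M`
at `p` iff it holds in `N` at `m ∘ p`. -/
def IsElementary {S : Signature.{w}} (κ : Cardinal.{w}) {M N : Str S} (m : M ⟶ N) : Prop :=
  Mono m ∧ ∀ (V : Type w) (t : V → S.Srt) (φ : Formula S κ t) (p : ∀ v, M.carrier (t v)),
    φ.Sat M p ↔ φ.Sat N (fun v => Str.Hom.toFun m (t v) (p v))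

/-! ### Subcategories that need not be full -/

/-- A (not necessarily full) subcategory of `L`: a class of objects and a class of morphisms
between them, containing the identities and closed under composition. -/
structure Subcat (L : Type u) [Category.{w} L] where
  obj : ObjectProperty L
  mor : MorphismProperty L
  source_mem : ∀ {X Y : L} (f : X ⟶ Y), mor f → obj X
  target_mem : ∀ {X Y : L} (f : X ⟶ Y), mor f → obj Y
  id_mem : ∀ X : L, obj X → mor (𝟙 X)
  comp_mem : ∀ {X Y Z : L} (f : X ⟶ Y) (g : Y ⟶ Z), mor f → mor g → mor (f ≫ g)

namespace Subcat

variable {L : Type u} [Category.{w} L]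

/-- The objects of a subcategory. -/
@[ext]
structure Obj (K : Subcat L) : Type u where
  val : L
  property : K.obj val

instance (K : Subcat L) : Category.{w} K.Obj where
  Hom X Y := { f : X.val ⟶ Y.val // K.mor f }
  id X := ⟨𝟙 X.val, K.id_mem X.val X.property⟩
  comp f g := ⟨f.1 ≫ g.1, K.comp_mem f.1 g.1 f.2 g.2⟩

/-- The inclusion functor of a subcategory. -/
def incl (K : Subcat L) : K.Obj ⥤ L where
  obj X := X.val
  map f := f.1

/-- The subcategory is reflective: its inclusion has a left adjoint. -/
def IsReflective (K : Subcat L) : Prop := K.incl.IsRightAdjoint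

/-- Closed under limits: the subcategory has all small limits and the inclusion
preserves them. -/
def ClosedUnderLimits (K : Subcat L) : Prop :=
  HasLimitsOfSize.{w, w} K.Obj ∧ PreservesLimitsOfSize.{w, w} K.incl

/-- Closed under `κ`-filtered colimits: the subcategory has all small `κ`-filtered colimits
and the inclusion preserves them. -/
def ClosedUnderFilteredColimits (K : Subcat L) (κ : Cardinal.{w}) [Fact κ.IsRegular] : Prop :=
  HasCardinalFilteredColimits.{w} K.Obj κ ∧ K.incl.IsCardinalAccessible κ

/-- Closed under `κ`-elementary embeddings: for some signature `S` and some full, reflective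
embedding `E` of `L` into `S`-structures preserving `κ`-filtered colimits, every morphism
`m : X ⟶ Y` of `L` with `Y` in the subcategory and `E m` a `κ`-elementary embedding lies in the
subcategory, together with its domain `X`. -/
def ClosedUnderElementary (K : Subcat L) (κ : Cardinal.{w}) [Fact κ.IsRegular] : Prop :=
  ∃ (S : Signature.{w}) (E : L ⥤ Str S),
    E.Full ∧ E.Faithful ∧ E.IsRightAdjoint ∧ E.IsCardinalAccessible κ ∧
      ∀ {X Y : L} (m : X ⟶ Y), K.obj Y → IsElementary κ (E.map m) → K.obj X ∧ K.mor m

end Subcat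

end ElemRefl

/-! Reflectivity comes from the adjoint functor theorem, whose solution sets are supplied by a
downward Löwenheim–Skolem argument: every `f : X ⟶ Z` factors as `g ≫ m` with `E m` elementary and
the middle object taken from a set depending only on `X`. If `Z` lies in `K`, closure under
elementary embeddings puts the middle object and `m` in `K`.

The argument runs inside `L`. The left adjoint of `E` turns tuples of elements of `E Y` into
morphisms from representing objects to `Y`. For large regular `θ`, formulas become `Code`s,
evaluated on morphisms out of `θ`-presentable objects (`coded_formula`). Unlike formulas, codes form
a small type, so one can close under witnesses for all of them. Contexts may be too large to be
presentable; `Coded` records that a formula depends only on a presentable part of its context. In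
`exists_tarskiVaught_factorization`, `Z` is a directed colimit of `θ`-presentables, and a small
subdiagram closed under witnesses has the required colimit.

For local presentability, a pullback argument (`mor_of_comp`) shows that the elementary factor of a
cocone in `K` again has its legs in `K`. This gives solution sets for colimits of `K`. The
reflections of a strong generator of `L` then form one of `K`. -/

namespace ElemRefl

/-! ### Small directed subsets closed under a family of unary operations -/

/-- Terms for the elements of the closure of a point under a family of unary operations indexed
by `Q` and under upper bounds of families indexed by subsets of `B`. -/
inductive ClosureTerm (Q B : Type w) : Type w
  | base : ClosureTerm Q B
  | bound (s : Set B) (f : s → ClosureTerm Q B) : ClosureTerm Q B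
  | step (q : Q) (a : ClosureTerm Q B) : ClosureTerm Q B

/-- The value of a closure term, for a given choice of upper bounds and unary operations. -/
def ClosureTerm.eval {Q B α : Type w} (a₀ : α) (ub : ∀ s : Set B, (s → α) → α) (op : Q → α → α) :
    ClosureTerm Q B → α
  | .base => a₀
  | .bound s f => ub s (fun b => (f b).eval a₀ ub op)
  | .step q a => op q (a.eval a₀ ub op)

/-- The closure is the image of the type of closure terms, which depends on `θ` and `Q` but not on
`α`; hence the uniform bound `τ`. Families of size less than `θ` are indexed by subsets of a set of
cardinality `θ`. -/
theorem exists_closed_directed_subset (θ : Cardinal.{w}) [Fact θ.IsRegular] (Q : Type w) :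
    ∃ (τ : Cardinal.{w}) (_ : Fact τ.IsRegular), θ ≤ τ ∧
      ∀ (α : Type w) [PartialOrder α] [IsCardinalFiltered α θ] (a₀ : α) (op : Q → α → α),
        ∃ D : Set α, a₀ ∈ D ∧ (∀ q, ∀ a ∈ D, op q a ∈ D) ∧ HasCardinalLT (Arrow D) τ ∧
          IsCardinalFiltered D θ := by
  let B : Type w := θ.ord.ToType
  obtain ⟨τ, hτ, hlt⟩ := HasCardinalLT.exists_regular_cardinal_forall.{w}
    (Sum.elim (fun _ : Unit => ClosureTerm Q B) (fun _ : Unit => B))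
  have : Fact τ.IsRegular := ⟨hτ⟩
  refine ⟨τ, this, ?_, ?_⟩
  · have := hlt (Sum.inr ⟨⟩)
    rw [hasCardinalLT_iff_cardinal_mk_lt] at this
    simpa [B] using this.le
  · intro α _ _ a₀ op
    have hub : ∀ (s : Set B) (f : s → α), ∃ a, HasCardinalLT s θ → ∀ b, f b ≤ a := by
      intro s f
      by_cases hs : HasCardinalLT s θ
      · exact ⟨IsCardinalFiltered.max f hs, fun _ b => leOfHom (IsCardinalFiltered.toMax f hs b)⟩
      -- A subset of `B` may have full cardinality `θ`, and then no bound is available: `a₀` is a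
      -- dummy value.
      · exact ⟨a₀, fun h => absurd h hs⟩
    choose ub hub using hub
    refine ⟨Set.range (ClosureTerm.eval a₀ ub op), ⟨.base, rfl⟩, ?_, ?_, ?_⟩
    · rintro q _ ⟨a, rfl⟩
      exact ⟨.step q a, rfl⟩
    · have hD : HasCardinalLT (Set.range (ClosureTerm.eval a₀ ub op)) τ :=
        (hlt (Sum.inl ⟨⟩)).of_surjective _ Set.rangeFactorization_surjective
      refine (hasCardinalLT_prod hτ.aleph0_le hD hD).of_injective
        (fun f => (f.left, f.right)) ?_
      rintro ⟨a, b, f⟩ ⟨a', b', f'⟩ h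
      obtain ⟨rfl, rfl⟩ := Prod.mk.inj h
      obtain rfl := Subsingleton.elim f f'
      rfl
    · refine isCardinalFiltered_preorder _ _ fun ι s hι => ?_
      have : Cardinal.mk ι ≤ Cardinal.mk B := by simpa [B] using hι.le
      obtain ⟨e⟩ := Cardinal.le_def _ _ |>.1 this
      choose t ht using fun i => (s i).2
      let e' : ι ≃ Set.range e := Equiv.ofInjective e e.injective
      refine ⟨⟨_, .bound (Set.range e) (fun b => t (e'.symm b)), rfl⟩, fun i => ?_⟩
      have hr : HasCardinalLT (Set.range e) θ := by
        rw [← hasCardinalLT_iff_of_equiv e', hasCardinalLT_iff_cardinal_mk_lt]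
        exact hι
      have := hub (Set.range e) (fun b => ClosureTerm.eval a₀ ub op (t (e'.symm b))) hr (e' i)
      rw [Equiv.symm_apply_apply, ht] at this
      exact this

/-! ### A small infinitary language interpreted in hom-sets -/

variable {L : Type u} [Category.{w} L]

/-- Codes for properties of morphisms `G c ⟶ Y`, with conjunctions indexed by subsets of `A`.
`ex u φ` says that the morphism extends along `u` to one that satisfies `φ`. -/
inductive Code {ι : Type w} (G : ι → L) (A : Type w) : ι → Type w
  | neg {c : ι} (φ : Code G A c) : Code G A c
  | conj {c : ι} (s : Set A) (φ : s → Code G A c) : Code G A c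
  | ex {c c' : ι} (u : G c ⟶ G c') (φ : Code G A c') : Code G A c
  | subst {c c' : ι} (u : G c ⟶ G c') (φ : Code G A c) : Code G A c'

namespace Code

variable {ι : Type w} {G : ι → L} {A : Type w}

/-- Satisfaction of a code by a morphism. -/
def Sat (Y : L) : {c : ι} → Code G A c → (G c ⟶ Y) → Prop
  | _, neg φ, x => ¬ φ.Sat Y x
  | _, conj _ φ, x => ∀ a, (φ a).Sat Y x
  | _, ex (c' := c') u φ, x => ∃ y : G c' ⟶ Y, u ≫ y = x ∧ φ.Sat Y y
  | _, subst u φ, x => φ.Sat Y (u ≫ x)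

/-- The code satisfied by all morphisms. -/
def top (c : ι) : Code G A c := conj ∅ (fun a => absurd a.2 (Set.notMem_empty _))

theorem sat_top {c : ι} {Y : L} (x : G c ⟶ Y) : (top c : Code G A c).Sat Y x :=
  fun a => absurd a.2 (Set.notMem_empty _)

end Code

/-- The Tarski–Vaught condition for a morphism, with respect to the codes over `G`. -/
def TarskiVaught {ι : Type w} (G : ι → L) (A : Type w) {Y Z : L} (m : Y ⟶ Z) : Prop :=
  ∀ (c c' : ι) (u : G c ⟶ G c') (φ : Code G A c') (x : G c ⟶ Y) (z : G c' ⟶ Z),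
    u ≫ z = x ≫ m → φ.Sat Z z → ∃ y : G c' ⟶ Y, u ≫ y = x ∧ φ.Sat Z (y ≫ m)

/-- Only `ex` uses the condition: a witness in `Z` is replaced by one coming from `Y`, and the
induction hypothesis carries its satisfaction back to `Y`. -/
theorem TarskiVaught.sat_iff {ι : Type w} {G : ι → L} {A : Type w} {Y Z : L} {m : Y ⟶ Z}
    (hm : TarskiVaught G A m) {c : ι} (φ : Code G A c) (x : G c ⟶ Y) :
    φ.Sat Y x ↔ φ.Sat Z (x ≫ m) := by
  induction φ with
  | neg φ ih => exact not_congr (ih x)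
  | conj s φ ih => exact forall_congr' fun a => ih a x
  | ex u φ ih =>
    constructor
    · rintro ⟨y, rfl, hy⟩
      exact ⟨y ≫ m, by simp, (ih y).1 hy⟩
    · rintro ⟨z, hz, hφ⟩
      obtain ⟨y, hy, hy'⟩ := hm _ _ u φ x z hz hφ
      exact ⟨y, hy, (ih y).2 hy'⟩
  | subst u φ ih => simpa [Code.Sat] using ih (u ≫ x)

theorem tarskiVaught_of_isIso {ι : Type w} (G : ι → L) (A : Type w) {Y Z : L} (m : Y ⟶ Z)
    [IsIso m] : TarskiVaught G A m :=
  fun _ _ u φ x z h hz => ⟨z ≫ inv m, by rw [← Category.assoc, h]; simp, by simpa using hz⟩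

/-- Downward Löwenheim–Skolem: any morphism out of a `θ`-presentable object factors through a
Tarski–Vaught morphism whose domain has presentability rank bounded independently of the target. -/
theorem exists_tarskiVaught_factorization (θ : Cardinal.{w}) [Fact θ.IsRegular]
    [IsCardinalLocallyPresentable L θ] {ι : Type w} (G : ι → L)
    (hG : ∀ c, IsCardinalPresentable (G c) θ)
    (hG' : ∀ Y : L, IsCardinalPresentable Y θ → ∃ c, Nonempty (G c ≅ Y)) (A : Type w) :
    ∃ (τ : Cardinal.{w}) (_ : Fact τ.IsRegular),
      ∀ (X : L) [IsCardinalPresentable X θ] (Z : L) (f : X ⟶ Z),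
        ∃ (Y : L) (g : X ⟶ Y) (m : Y ⟶ Z),
          IsCardinalPresentable Y τ ∧ g ≫ m = f ∧ TarskiVaught G A m := by
  -- All possible instances of the Tarski–Vaught condition. The parameter takes values in a
  -- representative `G n` of a stage of the diagram, so that `Q` does not depend on `Z`.
  let Q : Type w := Σ (c : ι) (c' : ι) (n : ι), (G c ⟶ G c') × Code G A c' × (G c ⟶ G n)
  obtain ⟨τ, _, hθτ, hcl⟩ := exists_closed_directed_subset θ Q
  refine ⟨τ, inferInstance, fun X _ Z f => ?_⟩
  obtain ⟨J, _, _, ⟨p⟩⟩ :=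
    (isCardinalFilteredGenerator_isCardinalPresentable L θ).exists_colimitsOfShape Z
  obtain ⟨α, _, _, F₀, _⟩ := IsCardinalFiltered.exists_cardinal_directed J θ
  let p' := p.reindex F₀
  let F : α ⥤ L := p'.diag
  let cc : Cocone F := p'.cocone
  have hcc : IsColimit cc := p'.isColimit
  have hF : ∀ a, IsCardinalPresentable (F.obj a) θ := fun a => p'.prop_diag_obj a
  choose n e using fun a => hG' (F.obj a) (hF a)
  replace e := fun a => (e a).some
  -- The instance `q`, with parameter at stage `a`, has a witness at the later stage `b`.
  -- Satisfaction is tested in `Z`, so it survives passage to later stages.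
  let good (a : α) (q : Q) (b : α) : Prop :=
    ∃ (h : a ≤ b) (hn : q.2.2.1 = n a) (y : G q.2.1 ⟶ F.obj b),
      q.2.2.2.1 ≫ y = q.2.2.2.2.2 ≫ eqToHom (by rw [hn]) ≫ (e a).hom ≫ F.map (homOfLE h) ∧
        q.2.2.2.2.1.Sat Z (y ≫ cc.ι.app b)
  have hop : ∀ (q : Q) (a : α), ∃ b, (∃ b', good a q b') → good a q b := by
    intro q a
    by_cases h : ∃ b', good a q b'
    · exact ⟨h.choose, fun _ => h.choose_spec⟩
    · exact ⟨a, fun h' => absurd h' h⟩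
  choose op hop using hop
  obtain ⟨a₀, f₀, hf₀⟩ := IsCardinalPresentable.exists_hom_of_isColimit θ hcc f
  obtain ⟨D, ha₀, hD, hcard, hfil⟩ := hcl α a₀ op
  let incl : D ⥤ α := Monotone.functor (f := Subtype.val) (fun _ _ h => h)
  let FD : D ⥤ L := incl ⋙ F
  let Y := colimit FD
  let m : Y ⟶ Z := colimit.desc FD (cc.whisker incl)
  let k (a : D) : F.obj a.1 ⟶ Y := colimit.ι FD a
  have hm (a : D) : k a ≫ m = cc.ι.app a.1 := colimit.ι_desc _ _
  have hk (a b : D) (h : a.1 ≤ b.1) : F.map (homOfLE h) ≫ k b = k a :=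
    colimit.w FD (homOfLE h : a ⟶ b)
  have hY (W : L) [IsCardinalPresentable W θ] (x : W ⟶ Y) :
      ∃ (a : D) (x' : W ⟶ F.obj a.1), x' ≫ k a = x :=
    IsCardinalPresentable.exists_hom_of_isColimit θ (colimit.isColimit FD) x
  refine ⟨Y, f₀ ≫ k ⟨a₀, ha₀⟩, m, ?_, ?_, ?_⟩
  · have : ∀ a, IsCardinalPresentable (FD.obj a) τ := fun a =>
      have := hF a.1
      isCardinalPresentable_of_le (F.obj a.1) hθτ
    exact isCardinalPresentable_of_isColimit _ (colimit.isColimit FD) τ hcard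
  · simp only [Category.assoc, hm, hf₀]
  · intro c c' u φ x z hxz hz
    have := hG c
    have := hG c'
    have := isFiltered_of_isCardinalFiltered α θ
    obtain ⟨a, x', rfl⟩ := hY _ x
    obtain ⟨b, z', hz'⟩ := IsCardinalPresentable.exists_hom_of_isColimit θ hcc z
    have hxz' : (u ≫ z') ≫ cc.ι.app b = x' ≫ cc.ι.app a.1 := by
      rw [Category.assoc, hz', hxz, Category.assoc, hm]
    -- The given witness lives at stage `b` and extends the parameter only in `Z`; by presentability
    -- it does so already at some stage `d`. Thus a good stage exists, and `op` picks one inside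
    -- `D`.
    obtain ⟨d, v₁, v₂, hd⟩ := IsCardinalPresentable.exists_eq_of_isColimit θ hcc (u ≫ z') x' hxz'
    have hex : ∃ b', good a.1 ⟨c, c', n a.1, u, φ, x' ≫ (e a.1).inv⟩ b' := by
      refine ⟨d, leOfHom v₂, rfl, z' ≫ F.map v₁, ?_, ?_⟩
      · have : u ≫ z' ≫ F.map v₁ = x' ≫ F.map (homOfLE (leOfHom v₂)) := by
          rw [← Category.assoc]
          exact hd
        simp [this]
      · have : (z' ≫ F.map v₁) ≫ cc.ι.app d = z := by rw [Category.assoc, cc.w, hz']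
        rw [this]
        exact hz
    obtain ⟨h, _, y, hy, hy'⟩ := hop _ a.1 hex
    replace hy : u ≫ y = x' ≫ F.map (homOfLE h) := by simpa using hy
    refine ⟨y ≫ k ⟨_, hD _ a.1 a.2⟩, ?_, ?_⟩
    · rw [← Category.assoc, hy, Category.assoc, hk a ⟨_, hD _ a.1 a.2⟩]
    · rw [Category.assoc, hm]
      exact hy'

/-! ### Properties of morphisms out of a fixed object that are given by codes -/

section Coded

variable {L : Type u} [Category.{w} L]

/-- A property of the morphisms out of `P` is coded if it is a code evaluated on the restriction
along some morphism `G c ⟶ P`. -/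
def Coded {ι : Type w} (G : ι → L) (A : Type w) (P : L) (Φ : ∀ Y : L, (P ⟶ Y) → Prop) : Prop :=
  ∃ (c : ι) (u : G c ⟶ P) (ψ : Code G A c), ∀ (Y : L) (x : P ⟶ Y), Φ Y x ↔ ψ.Sat Y (u ≫ x)

theorem isCardinalPresentable_sigma [HasColimitsOfSize.{w, w} L] (θ : Cardinal.{w})
    [Fact θ.IsRegular] {I : Type w} (hI : Cardinal.mk I < θ) (X : I → L)
    (hX : ∀ i, IsCardinalPresentable (X i) θ) : IsCardinalPresentable (∐ X) θ := by
  have : ∀ i, IsCardinalPresentable ((Discrete.functor X).obj i) θ := fun i => hX i.as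
  exact isCardinalPresentable_of_isColimit _ (colimit.isColimit (Discrete.functor X)) θ
    (by rwa [hasCardinalLT_arrow_discrete_iff, hasCardinalLT_iff_cardinal_mk_lt])

theorem isCardinalPresentable_coprod [HasColimitsOfSize.{w, w} L] [HasBinaryCoproducts L]
    (θ : Cardinal.{w}) [hθ : Fact θ.IsRegular] (X Y : L) [IsCardinalPresentable X θ]
    [IsCardinalPresentable Y θ] : IsCardinalPresentable (X ⨿ Y) θ := by
  have : ∀ i, IsCardinalPresentable ((pair X Y).obj i) θ := by
    rintro ⟨_ | _⟩ <;> dsimp <;> infer_instance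
  exact isCardinalPresentable_of_isColimit _ (colimit.isColimit (pair X Y)) θ
    (by
      rw [hasCardinalLT_arrow_discrete_iff]
      exact hasCardinalLT_of_finite _ _ hθ.out.aleph0_le)

/-- The universal property of a binary coproduct. -/
def IsCoproduct {P W N : L} (i : P ⟶ N) (k : W ⟶ N) : Prop :=
  ∀ (T : L) (a : P ⟶ T) (b : W ⟶ T), ∃! z : N ⟶ T, i ≫ z = a ∧ k ≫ z = b

/-- Filtered colimits commute with binary coproducts with a fixed object; in particular a morphism
from a presentable object to the coproduct of a colimit with `W` factors through a stage. -/
theorem exists_factorization_coprod [HasBinaryCoproducts L] (θ : Cardinal.{w}) [Fact θ.IsRegular]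
    {J : Type w} [SmallCategory J] [IsCardinalFiltered J θ] {F : J ⥤ L} {c : Cocone F}
    (hc : IsColimit c) {W N : L} {i : c.pt ⟶ N} {k : W ⟶ N} (hN : IsCoproduct i k)
    {X : L} [IsCardinalPresentable X θ] (u : X ⟶ N) :
    ∃ (j : J) (v : X ⟶ F.obj j ⨿ W), v ≫ coprod.desc (c.ι.app j ≫ i) k = u := by
  have := isFiltered_of_isCardinalFiltered J θ
  choose D hD hD' using fun T a b => hN T a b
  let H : J ⥤ L :=
    { obj := fun j => F.obj j ⨿ W
      map := fun f => coprod.map (F.map f) (𝟙 W) }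
  let d : Cocone H :=
    { pt := N
      ι := { app := fun j => coprod.desc (c.ι.app j ≫ i) k
             naturality := fun i j f => by apply coprod.hom_ext <;> simp [H] } }
  -- The components on `W` agree at all stages because `J` is connected, so a cocone on `H` amounts
  -- to a cocone on `F` and a single morphism out of `W`.
  let r (s : Cocone H) (j : J) : W ⟶ s.pt := coprod.inr (X := F.obj j) ≫ s.ι.app j
  have hr (s : Cocone H) (i j : J) : r s i = r s j := by
    have key : ∀ {i j : J} (f : i ⟶ j), r s i = r s j := fun {i j} f => by
      have h := s.w f
      simp only [r]
      rw [← h]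
      simp [H]
    exact (key (IsFiltered.leftToMax i j)).trans (key (IsFiltered.rightToMax i j)).symm
  let l (s : Cocone H) : Cocone F :=
    { pt := s.pt
      ι := { app := fun j => coprod.inl (Y := W) ≫ s.ι.app j
             naturality := fun i j f => by
              have h := s.w f
              simp only [← h]
              simp [H] } }
  let j₀ : J := (IsFiltered.nonempty (C := J)).some
  have hd : IsColimit d :=
    { desc := fun s => D _ (hc.desc (l s)) (r s j₀)
      fac := fun s j => by
        apply coprod.hom_ext
        · simp only [d, coprod.inl_desc_assoc, Category.assoc, (hD _ _ _).1, hc.fac]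
          rfl
        · simp only [d, coprod.inr_desc_assoc, (hD _ _ _).2]
          exact hr s j₀ j
      uniq := fun s m hm => by
        refine hD' _ _ _ _ ⟨hc.hom_ext fun j => ?_, ?_⟩
        · rw [hc.fac]
          simp only [l, ← hm j, d, coprod.inl_desc_assoc, Category.assoc]
        · simp only [r, ← hm j₀, d, coprod.inr_desc_assoc] }
  exact IsCardinalPresentable.exists_hom_of_isColimit θ hd u

variable (θ : Cardinal.{w}) [Fact θ.IsRegular] {ι : Type w} {G : ι → L}
  (hG : ∀ c, IsCardinalPresentable (G c) θ)
  (hG' : ∀ Y : L, IsCardinalPresentable Y θ → ∃ c, Nonempty (G c ≅ Y)) {A : Type w}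

theorem Coded.neg {P : L} {Φ : ∀ Y : L, (P ⟶ Y) → Prop} (h : Coded G A P Φ) :
    Coded G A P (fun Y x => ¬ Φ Y x) := by
  obtain ⟨c, u, ψ, h⟩ := h
  exact ⟨c, u, .neg ψ, fun Y x => not_congr (h Y x)⟩

include hG' in
-- This covers the atomic formulas: equality is extension along a codiagonal, a relation is
-- extension along `relMap`.
theorem coded_factors {P W W' : L} (hW : IsCardinalPresentable W θ)
    (hW' : IsCardinalPresentable W' θ) (v : W ⟶ W') (u : W ⟶ P) :
    Coded G A P (fun Y x => ∃ y : W' ⟶ Y, v ≫ y = u ≫ x) := by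
  obtain ⟨c, ⟨e⟩⟩ := hG' W hW
  obtain ⟨c', ⟨e'⟩⟩ := hG' W' hW'
  refine ⟨c, e.hom ≫ u, .ex (e.hom ≫ v ≫ e'.inv) (.top c'), fun Y x => ⟨?_, ?_⟩⟩
  · rintro ⟨y, hy⟩
    exact ⟨e'.hom ≫ y, by simp [hy], Code.sat_top _⟩
  · rintro ⟨y, hy, -⟩
    exact ⟨e'.inv ≫ y, by simpa using hy⟩

include hG hG' in
-- The presentable parts used by the conjuncts are merged into their coproduct, still
-- `θ`-presentable as there are fewer than `θ` of them; `subst` along the coprojections recovers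
-- each conjunct.
theorem Coded.forall [HasColimitsOfSize.{w, w} L] {P : L} {I : Type w} (hI : Cardinal.mk I < θ)
    (hA : Cardinal.mk I ≤ Cardinal.mk A) {Φ : I → ∀ Y : L, (P ⟶ Y) → Prop}
    (h : ∀ i, Coded G A P (Φ i)) : Coded G A P (fun Y x => ∀ i, Φ i Y x) := by
  choose c u ψ h using h
  obtain ⟨e⟩ := Cardinal.le_def _ _ |>.1 hA
  let e' : I ≃ Set.range e := Equiv.ofInjective e e.injective
  obtain ⟨d, ⟨k⟩⟩ := hG' (∐ fun i => G (c i)) (isCardinalPresentable_sigma θ hI _ fun i => hG _)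
  refine ⟨d, k.hom ≫ Sigma.desc u, .conj (Set.range e) (fun a =>
    .subst (Sigma.ι (fun i => G (c i)) (e'.symm a) ≫ k.inv) (ψ (e'.symm a))), fun Y x => ?_⟩
  have hs (a) : Code.Sat Y (.subst (Sigma.ι (fun i => G (c i)) (e'.symm a) ≫ k.inv)
      (ψ (e'.symm a))) ((k.hom ≫ Sigma.desc u) ≫ x) ↔ Φ (e'.symm a) Y x := by
    rw [h]
    simp [Code.Sat]
  exact ⟨fun H a => (hs a).2 (H _), fun H i => by simpa using (hs (e' i)).1 (H _)⟩

include hG hG' in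
-- With `P` a filtered colimit of presentables `Pⱼ`, the part of `N` that matters factors through
-- some `Pⱼ ⨿ W`. Since `P ⟶ N` is a pushout of `Pⱼ ⟶ Pⱼ ⨿ W`, extending along one amounts to
-- extending along the other.
theorem Coded.exists [IsCardinalLocallyPresentable L θ] {P W N : L}
    (hW : IsCardinalPresentable W θ) {i : P ⟶ N} {k : W ⟶ N} (hN : IsCoproduct i k)
    {Φ : ∀ Y : L, (N ⟶ Y) → Prop} (h : Coded G A N Φ) :
    Coded G A P (fun Y x => ∃ z : N ⟶ Y, i ≫ z = x ∧ Φ Y z) := by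
  obtain ⟨c, u, ψ, h⟩ := h
  have : HasColimitsOfSize.{0, 0} L := hasColimitsOfSizeShrink.{0, 0, w, w} L
  obtain ⟨J, _, _, ⟨p⟩⟩ :=
    (isCardinalFilteredGenerator_isCardinalPresentable L θ).exists_colimitsOfShape P
  have := hG c
  obtain ⟨j, v, hv⟩ := exists_factorization_coprod θ p.isColimit hN u
  replace hv : v ≫ coprod.desc (p.ι.app j ≫ i) k = u := hv
  have hj : IsCardinalPresentable (p.diag.obj j) θ := p.prop_diag_obj j
  obtain ⟨c₁, ⟨e₁⟩⟩ := hG' _ hj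
  obtain ⟨c₂, ⟨e₂⟩⟩ := hG' _ (isCardinalPresentable_coprod θ (p.diag.obj j) W)
  let pj : p.diag.obj j ⟶ P := p.ι.app j
  change v ≫ coprod.desc (pj ≫ i) k = u at hv
  refine ⟨c₁, e₁.hom ≫ pj, .ex (e₁.hom ≫ coprod.inl ≫ e₂.inv) (.subst (v ≫ e₂.inv) ψ),
    fun Y x => ⟨?_, ?_⟩⟩
  · rintro ⟨z, rfl, hz⟩
    refine ⟨e₂.hom ≫ coprod.desc (pj ≫ i) k ≫ z, by simp [coprod.inl_desc], ?_⟩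
    rw [h, ← hv] at hz
    simpa [Code.Sat] using hz
  · rintro ⟨y, hy, hy'⟩
    obtain ⟨z, ⟨hz₁, hz₂⟩, -⟩ := hN Y x (coprod.inr ≫ e₂.inv ≫ y)
    refine ⟨z, hz₁, ?_⟩
    rw [h, ← hv]
    have : coprod.desc (pj ≫ i) k ≫ z = e₂.inv ≫ y := by
      apply coprod.hom_ext
      · simpa [hz₁, coprod.inl_desc] using hy.symm
      · simp [hz₂, coprod.inr_desc]
    rw [Category.assoc, this]
    simpa [Code.Sat] using hy'

end Coded

/-! ### Tuples of elements as morphisms out of free structures -/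

section Free

variable {S : Signature.{w}}

theorem Str.Hom.map_eval {M N : Str S} (f : M ⟶ N) {V : Type w} {t : V → S.Srt}
    (p : ∀ v, M.carrier (t v)) {s : S.Srt} (a : Term S t s) :
    Str.Hom.toFun f s (a.eval M p) = a.eval N (fun v => Str.Hom.toFun f (t v) (p v)) := by
  induction a with
  | var v => rfl
  | app o a ih =>
    simp only [Term.eval]
    rw [Str.Hom.map_op]
    exact congrArg _ (funext ih)

/-- The structure of terms in the variables `t` with the relations `Q`. -/
def freeStr {V : Type w} (t : V → S.Srt)
    (Q : ∀ r : S.Rel, (∀ i : S.RelArity r, Term S t (S.relIn r i)) → Prop) : Str S where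
  carrier := Term S t
  op := .app
  rel := Q

/-- Homomorphisms out of a free structure are the interpretations of the variables that satisfy
the relations. -/
def freeStrHomEquiv {V : Type w} (t : V → S.Srt)
    (Q : ∀ r : S.Rel, (∀ i : S.RelArity r, Term S t (S.relIn r i)) → Prop) (M : Str S) :
    (freeStr t Q ⟶ M) ≃
      {p : ∀ v, M.carrier (t v) // ∀ r a, Q r a → M.rel r (fun i => (a i).eval M p)} where
  toFun f := ⟨fun v => Str.Hom.toFun f (t v) (.var v), fun r a h => by
    have hev : ∀ {s : S.Srt} (b : Term S t s), b.eval (freeStr t Q) (fun v => Term.var v) = b := by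
      intro s b
      induction b with
      | var v => rfl
      | app o a ih => exact congrArg (Term.app o) (funext ih)
    have key : ∀ i, (a i).eval M (fun v => Str.Hom.toFun f (t v) (.var v)) =
        Str.Hom.toFun f _ (a i) := fun i => by
      rw [← Str.Hom.map_eval f (fun v => Term.var v) (a i), hev]
    simp only [key]
    exact Str.Hom.map_rel f r a h⟩
  invFun p := ⟨fun _ a => a.eval M p.1, fun _ _ => rfl, p.2⟩
  left_inv f := by
    apply Str.Hom.ext
    funext s a
    induction a with
    | var v => rfl
    | app o a ih =>
      exact (congrArg (M.op o) (funext ih)).trans (Str.Hom.map_op f o a).symm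
  right_inv p := rfl

/-- The relation satisfied in the structure freely generated by a tuple in `r`: it holds only for
that tuple of variables. -/
inductive GenericRel (r : S.Rel) :
    ∀ r' : S.Rel, (∀ i : S.RelArity r', Term S (S.relIn r) (S.relIn r' i)) → Prop
  | mk : GenericRel r r (fun i => .var i)

end Free

section Tuples

variable {L : Type u} [Category.{w} L] {S : Signature.{w}} {E : L ⥤ Str S} {R : Str S ⥤ L}
  (adj : R ⊣ E)

variable (R) in
/-- The object of `L` that represents tuples of elements of sorts `t`. -/
def tupleObj {V : Type w} (t : V → S.Srt) : L := R.obj (freeStr t fun _ _ => False)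

variable (R) in
/-- The object of `L` that represents tuples in the relation `r`. -/
def relObj (r : S.Rel) : L := R.obj (freeStr (S.relIn r) (GenericRel r))

/-- Morphisms out of `tupleObj R t` are tuples of elements. -/
def tupleEquiv {V : Type w} (t : V → S.Srt) (Y : L) :
    (tupleObj R t ⟶ Y) ≃ ∀ v, (E.obj Y).carrier (t v) :=
  ((adj.homEquiv _ Y).trans (freeStrHomEquiv t _ _)).trans
    (Equiv.subtypeUnivEquiv fun _ _ _ h => h.elim)

theorem tupleEquiv_comp {V : Type w} (t : V → S.Srt) {Y Z : L} (x : tupleObj R t ⟶ Y)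
    (m : Y ⟶ Z) (v : V) :
    tupleEquiv adj t Z (x ≫ m) v = Str.Hom.toFun (E.map m) (t v) (tupleEquiv adj t Y x v) := by
  change Str.Hom.toFun (adj.homEquiv _ Z (x ≫ m)) (t v) _ = _
  erw [adj.homEquiv_naturality_right]
  rfl

/-- The morphism between tuple objects given by a tuple of terms. -/
def termMap {V I : Type w} {t : V → S.Srt} {r : I → S.Srt} (a : ∀ i, Term S t (r i)) :
    tupleObj R r ⟶ tupleObj R t :=
  (tupleEquiv adj r _).symm fun i => (a i).eval _ (tupleEquiv adj t _ (𝟙 _))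

theorem tupleEquiv_termMap_comp {V I : Type w} {t : V → S.Srt} {r : I → S.Srt}
    (a : ∀ i, Term S t (r i)) {Y : L} (x : tupleObj R t ⟶ Y) (i : I) :
    tupleEquiv adj r Y (termMap adj a ≫ x) i = (a i).eval _ (tupleEquiv adj t Y x) := by
  rw [tupleEquiv_comp, termMap, Equiv.apply_symm_apply, Str.Hom.map_eval]
  congr 1
  funext v
  rw [← tupleEquiv_comp, Category.id_comp]

variable (R) in
/-- The morphism along which a tuple extends if and only if it is in the relation `r`. -/
def relMap (r : S.Rel) : tupleObj R (S.relIn r) ⟶ relObj R r :=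
  R.map ⟨fun _ a => a, fun _ _ => rfl, fun _ _ h => h.elim⟩

theorem exists_relMap_comp_iff (r : S.Rel) {Y : L} (x : tupleObj R (S.relIn r) ⟶ Y) :
    (∃ y : relObj R r ⟶ Y, relMap R r ≫ y = x) ↔
      (E.obj Y).rel r (tupleEquiv adj (S.relIn r) Y x) := by
  have key (y : relObj R r ⟶ Y) (v) : tupleEquiv adj (S.relIn r) Y (relMap R r ≫ y) v =
      (freeStrHomEquiv _ _ _ (adj.homEquiv _ Y y)).1 v := by
    change Str.Hom.toFun (adj.homEquiv _ Y (relMap R r ≫ y)) _ _ = _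
    erw [adj.homEquiv_naturality_left]
    rfl
  constructor
  · rintro ⟨y, rfl⟩
    rw [show tupleEquiv adj (S.relIn r) Y (relMap R r ≫ y) = _ from funext (key y)]
    exact (freeStrHomEquiv _ _ _ (adj.homEquiv _ Y y)).2 r _ .mk
  · intro h
    refine ⟨(adj.homEquiv _ Y).symm ((freeStrHomEquiv (S.relIn r) (GenericRel r) _).symm
      ⟨tupleEquiv adj (S.relIn r) Y x, ?_⟩), ?_⟩
    · rintro _ _ ⟨⟩
      exact h
    · apply (tupleEquiv adj (S.relIn r) Y).injective
      funext v
      refine (key _ v).trans ?_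
      rw [Equiv.apply_symm_apply, Equiv.apply_symm_apply]

variable {V W : Type w} (t : V → S.Srt) (t' : W → S.Srt)

/-- The restriction of tuples to the left part of a disjoint union of contexts. -/
def tupleInl : tupleObj R t ⟶ tupleObj R (Sum.elim t t') :=
  termMap adj (r := t) fun v => Term.var (t := Sum.elim t t') (.inl v)

/-- The restriction of tuples to the right part of a disjoint union of contexts. -/
def tupleInr : tupleObj R t' ⟶ tupleObj R (Sum.elim t t') :=
  termMap adj (r := t') fun x => Term.var (t := Sum.elim t t') (.inr x)

theorem tupleEquiv_inl {Y : L} (z : tupleObj R (Sum.elim t t') ⟶ Y) (v : V) :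
    tupleEquiv adj t Y (tupleInl adj t t' ≫ z) v =
      tupleEquiv adj (Sum.elim t t') Y z (.inl v) :=
  tupleEquiv_termMap_comp adj (r := t) _ z v

theorem tupleEquiv_inr {Y : L} (z : tupleObj R (Sum.elim t t') ⟶ Y) (x : W) :
    tupleEquiv adj t' Y (tupleInr adj t t' ≫ z) x =
      tupleEquiv adj (Sum.elim t t') Y z (.inr x) :=
  tupleEquiv_termMap_comp adj (r := t') _ z x

theorem tupleEquiv_eq_extend {Y : L} (z : tupleObj R (Sum.elim t t') ⟶ Y) :
    tupleEquiv adj (Sum.elim t t') Y z =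
      extend (E.obj Y) (tupleEquiv adj t Y (tupleInl adj t t' ≫ z))
        (tupleEquiv adj t' Y (tupleInr adj t t' ≫ z)) := by
  funext v
  cases v with
  | inl v => exact (tupleEquiv_inl adj t t' z v).symm
  | inr x => exact (tupleEquiv_inr adj t t' z x).symm

theorem isCoproduct_tupleInl_tupleInr :
    IsCoproduct (tupleInl adj t t') (tupleInr adj t t') := by
  intro T a b
  refine ⟨(tupleEquiv adj (Sum.elim t t') _).symm
      (extend _ (tupleEquiv adj t _ a) (tupleEquiv adj t' _ b)), ⟨?_, ?_⟩, ?_⟩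
  · apply (tupleEquiv adj t _).injective
    funext v
    rw [tupleEquiv_inl, Equiv.apply_symm_apply]
    rfl
  · apply (tupleEquiv adj t' _).injective
    funext v
    rw [tupleEquiv_inr, Equiv.apply_symm_apply]
    rfl
  · rintro z ⟨rfl, rfl⟩
    apply (tupleEquiv adj (Sum.elim t t') _).injective
    rw [Equiv.apply_symm_apply]
    exact tupleEquiv_eq_extend adj t t' z

include adj in
/-- A tuple object is presentable if its single-element contexts are. -/
theorem isCardinalPresentable_tupleObj (θ : Cardinal.{w}) [Fact θ.IsRegular]
    (hV : Cardinal.mk V < θ)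
    (h : ∀ s : S.Srt, IsCardinalPresentable (tupleObj R (fun _ : PUnit.{w + 1} => s)) θ) :
    IsCardinalPresentable (tupleObj R t) θ := by
  let c : Cofan fun v => tupleObj R (fun _ : PUnit.{w + 1} => t v) :=
    Cofan.mk (tupleObj R t) fun v => termMap adj fun _ => (.var v : Term S t _)
  have hι (Y : L) (z : tupleObj R t ⟶ Y) (v : V) :
      tupleEquiv adj _ Y (c.inj v ≫ z) ⟨⟩ = tupleEquiv adj t Y z v :=
    tupleEquiv_termMap_comp adj _ z _
  have hc : IsColimit c := by
    refine Cofan.IsColimit.mk c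
      (fun s => (tupleEquiv adj t _).symm fun v => tupleEquiv adj _ _ (s.inj v) ⟨⟩) ?_ ?_
    · intro s v
      apply (tupleEquiv adj _ _).injective
      funext x
      erw [hι]
      rw [Equiv.apply_symm_apply]
    · intro s m hm
      apply (tupleEquiv adj _ _).injective
      funext v
      rw [Equiv.apply_symm_apply, ← hm]
      exact (hι _ m v).symm
  have : ∀ i, IsCardinalPresentable ((Discrete.functor
      fun v => tupleObj R (fun _ : PUnit.{w + 1} => t v)).obj i) θ := fun i => h _
  exact isCardinalPresentable_of_isColimit c hc θ
    (by rwa [hasCardinalLT_arrow_discrete_iff, hasCardinalLT_iff_cardinal_mk_lt])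

/-- Every formula of `L_{κκ}` is coded. -/
theorem coded_formula (κ θ : Cardinal.{w}) [hθ : Fact θ.IsRegular] (hκθ : κ ≤ θ)
    [IsCardinalLocallyPresentable L θ] {ι : Type w} {G : ι → L}
    (hG : ∀ c, IsCardinalPresentable (G c) θ)
    (hG' : ∀ Y : L, IsCardinalPresentable Y θ → ∃ c, Nonempty (G c ≅ Y)) {A : Type w}
    (hA : Cardinal.mk A = κ)
    (hS : ∀ s : S.Srt, IsCardinalPresentable (tupleObj R (fun _ : PUnit.{w + 1} => s)) θ)
    (hR : ∀ r : S.Rel, IsCardinalPresentable (tupleObj R (S.relIn r)) θ)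
    (hR' : ∀ r : S.Rel, IsCardinalPresentable (relObj R r) θ)
    {V : Type w} {t : V → S.Srt} (φ : Formula S κ t) :
    Coded G A (tupleObj R t) (fun Y x => φ.Sat (E.obj Y) (tupleEquiv adj t Y x)) := by
  induction φ with
  | @equal V t s a b =>
    -- `ab` gives the pair of terms and `dg` the codiagonal from two variables to one; the terms
    -- agree exactly when the pair factors through it.
    let ab : ∀ _ : ULift.{w} Bool, Term S t s := fun i => if i.down then a else b
    let dg : ∀ _ : ULift.{w} Bool, Term S (fun _ : PUnit.{w + 1} => s) s := fun _ => .var ⟨⟩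
    have h2 : Cardinal.mk (ULift.{w} Bool) < θ :=
      (Cardinal.lt_aleph0_of_finite _).trans_le hθ.out.aleph0_le
    have h := coded_factors (G := G) (A := A) θ hG'
      (isCardinalPresentable_tupleObj adj (fun _ => s) θ h2 hS) (hS s) (termMap adj dg)
      (termMap adj ab)
    convert h using 3 with Y x
    simp only [Formula.Sat]
    constructor
    · intro hab
      refine ⟨(tupleEquiv adj (fun _ : PUnit.{w + 1} => s) Y).symm
        fun _ => a.eval _ (tupleEquiv adj t Y x), ?_⟩
      apply (tupleEquiv adj _ Y).injective
      funext i
      rw [tupleEquiv_termMap_comp, tupleEquiv_termMap_comp, Equiv.apply_symm_apply]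
      rcases i with ⟨_ | _⟩
      · exact hab
      · rfl
    · rintro ⟨y, hy⟩
      have hi (i) := congrFun (congrArg (tupleEquiv adj _ Y) hy) i
      simp only [tupleEquiv_termMap_comp] at hi
      exact (hi ⟨true⟩).symm.trans (hi ⟨false⟩)
  | @rel V t r a =>
    have h := coded_factors (G := G) (A := A) θ hG' (hR r) (hR' r) (relMap R r) (termMap adj a)
    convert h using 3 with Y x
    rw [exists_relMap_comp_iff adj]
    simp only [Formula.Sat]
    rw [show tupleEquiv adj (S.relIn r) Y (termMap adj a ≫ x) = _ from
      funext (tupleEquiv_termMap_comp adj a x)]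
  | neg φ ih => exact ih.neg
  | conj I hI φ ih => exact Coded.forall θ hG hG' (hI.trans_le hκθ) (hA ▸ hI.le) ih
  | @exist V t W hW t' φ ih =>
    have h := Coded.exists θ hG hG'
      (isCardinalPresentable_tupleObj adj t' θ (hW.trans_le hκθ) hS)
      (isCoproduct_tupleInl_tupleInr adj t t') ih
    convert h using 3 with Y x
    simp only [Formula.Sat]
    constructor
    · rintro ⟨q, hq⟩
      refine ⟨(tupleEquiv adj (Sum.elim t t') Y).symm (extend _ (tupleEquiv adj t Y x) q), ?_, ?_⟩
      · apply (tupleEquiv adj t Y).injective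
        funext v
        rw [tupleEquiv_inl, Equiv.apply_symm_apply]
        rfl
      · rw [Equiv.apply_symm_apply]
        exact hq
    · rintro ⟨z, rfl, hz⟩
      refine ⟨tupleEquiv adj t' Y (tupleInr adj t t' ≫ z), ?_⟩
      rw [← tupleEquiv_eq_extend]
      exact hz

theorem mono_of_injective {M N : Str S} (f : M ⟶ N)
    (h : ∀ s, Function.Injective (Str.Hom.toFun f s)) : Mono f where
  right_cancellation g g' hg := by
    apply Str.Hom.ext
    funext s x
    exact h s (congrFun (congrFun (congrArg Str.Hom.toFun hg) s) x)

theorem isElementary_of_sat_iff {κ : Cardinal.{w}} {M N : Str S} (m : M ⟶ N)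
    (h : ∀ (V : Type w) (t : V → S.Srt) (φ : Formula S κ t) (p : ∀ v, M.carrier (t v)),
      φ.Sat M p ↔ φ.Sat N (fun v => Str.Hom.toFun m (t v) (p v))) : IsElementary κ m := by
  refine ⟨mono_of_injective m fun s x y hxy => ?_, h⟩
  -- Injectivity is the case of the formula equating two variables.
  exact (h (ULift Bool) (fun _ => s) (.equal (s := s) (Term.var (t := fun _ => s) ⟨true⟩)
    (Term.var (t := fun _ => s) ⟨false⟩)) (fun i => bif i.down then x else y)).2 hxy

theorem isElementary_map_of_coded {κ : Cardinal.{w}} {ι : Type w} {G : ι → L} {A : Type w}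
    (h : ∀ {V : Type w} {t : V → S.Srt} (φ : Formula S κ t),
      Coded G A (tupleObj R t) (fun Y x => φ.Sat (E.obj Y) (tupleEquiv adj t Y x)))
    {Y Z : L} {m : Y ⟶ Z} (hm : TarskiVaught G A m) : IsElementary κ (E.map m) := by
  refine isElementary_of_sat_iff _ fun V t φ p => ?_
  obtain ⟨c, u, ψ, hψ⟩ := h φ
  obtain ⟨x, rfl⟩ := (tupleEquiv adj t Y).surjective p
  refine (hψ Y x).trans ?_
  rw [← show tupleEquiv adj t Z (x ≫ m) = _ from funext (tupleEquiv_comp adj t x m),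
    hm.sat_iff, Category.assoc]
  exact (hψ Z (x ≫ m)).symm

end Tuples

/-! ### Elementary factorizations in a locally presentable category -/

section Factorization

variable {L : Type u} [Category.{w} L]

theorem exists_regular_forall_isCardinalPresentable {ι : Type w} (X : ι → L)
    [∀ i, IsPresentable.{w} (X i)] (κ : Cardinal.{w}) :
    ∃ (θ : Cardinal.{w}) (_ : Fact θ.IsRegular), κ ≤ θ ∧ ∀ i, IsCardinalPresentable (X i) θ := by
  choose μ hμ h using fun i =>
    Functor.IsAccessible.exists_cardinal (F := coyoneda.obj (Opposite.op (X i)))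
  obtain ⟨θ, hθ, hlt⟩ := HasCardinalLT.exists_regular_cardinal_forall.{w}
    (Sum.elim (fun _ : PUnit.{w + 1} => κ.ord.ToType) (fun i => (μ i).ord.ToType))
  have : Fact θ.IsRegular := ⟨hθ⟩
  have hlt' := fun i => (hasCardinalLT_iff_cardinal_mk_lt _ _).1 (hlt i)
  refine ⟨θ, this, by simpa using (hlt' (.inl ⟨⟩)).le, fun i => ?_⟩
  have hi : μ i ≤ θ := by simpa using (hlt' (.inr i)).le
  have : IsCardinalPresentable (X i) (μ i) := h i
  exact isCardinalPresentable_of_le (X i) hi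

theorem exists_family_isCardinalPresentable (θ : Cardinal.{w}) [Fact θ.IsRegular]
    [IsCardinalLocallyPresentable L θ] :
    ∃ (ι : Type w) (G : ι → L), (∀ c, IsCardinalPresentable (G c) θ) ∧
      ∀ Y : L, IsCardinalPresentable Y θ → ∃ c, Nonempty (G c ≅ Y) := by
  obtain ⟨Q, _, hQ, hQ'⟩ :=
    ObjectProperty.EssentiallySmall.exists_small_le.{w} (isCardinalPresentable L θ)
  let e := equivShrink.{w} (Subtype Q)
  refine ⟨Shrink.{w} (Subtype Q), fun c => (e.symm c).1, fun c => hQ _ (e.symm c).2, ?_⟩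
  intro Y hY
  obtain ⟨Z, hZ, ⟨i⟩⟩ := hQ' Y hY
  refine ⟨e ⟨Z, hZ⟩, ?_⟩
  simp only [Equiv.symm_apply_apply]
  exact ⟨i.symm⟩

variable [IsLocallyPresentable.{w} L] {S : Signature.{w}} (E : L ⥤ Str S) [E.IsRightAdjoint]
  (κ : Cardinal.{w})

/-- Formulas of `L_{κκ}` are coded over the presentable objects of a rank that can be chosen
so large that a given object is presentable. -/
theorem exists_coding (X : L) :
    ∃ (θ : Cardinal.{w}) (_ : Fact θ.IsRegular) (_ : IsCardinalLocallyPresentable L θ)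
      (ι : Type w) (G : ι → L) (A : Type w), IsCardinalPresentable X θ ∧
        (∀ c, IsCardinalPresentable (G c) θ) ∧
        (∀ Y : L, IsCardinalPresentable Y θ → ∃ c, Nonempty (G c ≅ Y)) ∧
        ∀ {Y Z : L} (m : Y ⟶ Z), TarskiVaught G A m → IsElementary κ (E.map m) := by
  let R := E.leftAdjoint
  let adj : R ⊣ E := Adjunction.ofIsRightAdjoint E
  obtain ⟨μ, _, _⟩ := IsLocallyPresentable.exists_cardinal.{w} L
  let obj : Unit ⊕ S.Srt ⊕ S.Rel ⊕ S.Rel → L :=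
    Sum.elim (fun _ => X) (Sum.elim (fun s => tupleObj R (fun _ : PUnit.{w + 1} => s))
      (Sum.elim (fun r => tupleObj R (S.relIn r)) (relObj R)))
  obtain ⟨θ, _, hθ, hobj⟩ := exists_regular_forall_isCardinalPresentable obj (max κ μ)
  have hL : IsCardinalLocallyPresentable L θ :=
    IsCardinalLocallyPresentable.of_le L ((le_max_right κ μ).trans hθ)
  obtain ⟨ι, G, hG, hG'⟩ := exists_family_isCardinalPresentable (L := L) θ
  refine ⟨θ, inferInstance, hL, ι, G, κ.out, hobj (.inl ⟨⟩), hG, hG', fun m hm => ?_⟩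
  exact isElementary_map_of_coded adj (fun φ => coded_formula adj κ θ ((le_max_left κ μ).trans hθ)
    hG hG' κ.mk_out (fun s => hobj (.inr (.inl s))) (fun r => hobj (.inr (.inr (.inl r))))
    (fun r => hobj (.inr (.inr (.inr r)))) φ) hm

theorem isElementary_map_of_isIso {Y Z : L} (m : Y ⟶ Z) [IsIso m] :
    IsElementary κ (E.map m) := by
  obtain ⟨_, _, _, _, G, A, _, _, _, h⟩ := exists_coding E κ Y
  exact h m (tarskiVaught_of_isIso G A m)

theorem exists_elementary_factorization (X : L) :
    ∃ (ι : Type w) (B : ι → L), ∀ (Z : L) (f : X ⟶ Z),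
      ∃ (i : ι) (g : X ⟶ B i) (m : B i ⟶ Z), g ≫ m = f ∧ IsElementary κ (E.map m) := by
  obtain ⟨θ, _, _, ι, G, A, _, hG, hG', h⟩ := exists_coding E κ X
  obtain ⟨τ, _, hτ⟩ := exists_tarskiVaught_factorization θ G hG hG' A
  obtain ⟨μ, _, _⟩ := IsLocallyPresentable.exists_cardinal.{w} L
  -- Raising `τ` above a presentability rank of `L` makes the presentable objects essentially small,
  -- so the middle objects have a small set of representatives.
  have : Fact (max τ μ).IsRegular :=
    ⟨by rcases max_choice τ μ with h | h <;> rw [h] <;> exact Fact.out⟩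
  have : IsCardinalLocallyPresentable L (max τ μ) :=
    IsCardinalLocallyPresentable.of_le L (le_max_right τ μ)
  obtain ⟨ι', B, -, hB⟩ := exists_family_isCardinalPresentable (L := L) (max τ μ)
  refine ⟨ι', B, fun Z f => ?_⟩
  obtain ⟨Y, g, m, hY, hgm, hm⟩ := hτ X Z f
  obtain ⟨i, ⟨e⟩⟩ := hB Y (isCardinalPresentable_of_le Y (le_max_left τ μ))
  refine ⟨i, g ≫ e.inv, e.hom ≫ m, by simpa using hgm, h _ ?_⟩
  intro c c' u φ x z hxz hz
  obtain ⟨y, hy, hy'⟩ := hm c c' u φ (x ≫ e.hom) z (by simpa using hxz) hz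
  exact ⟨y ≫ e.inv, by rw [← Category.assoc, hy]; simp, by simpa using hy'⟩

end Factorization

/-! ### Subcategories closed under limits and elementary embeddings -/

namespace Subcat

variable {L : Type u} [Category.{w} L] {K : Subcat L}

instance : K.incl.Faithful where
  map_injective h := Subtype.ext h

variable [IsLocallyPresentable.{w} L] {κ : Cardinal.{w}} [Fact κ.IsRegular]

/-- Isomorphisms are elementary, so `K` is replete. -/
theorem ClosedUnderElementary.of_isIso (hK : K.ClosedUnderElementary κ) {X Y : L} (m : X ⟶ Y)
    [IsIso m] (hY : K.obj Y) : K.obj X ∧ K.mor m := by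
  obtain ⟨S, E, _, _, _, _, h⟩ := hK
  exact h m hY (isElementary_map_of_isIso E κ m)

theorem ClosedUnderElementary.reflectsIsomorphisms (hK : K.ClosedUnderElementary κ) :
    K.incl.ReflectsIsomorphisms where
  reflects {X Y} f hf := by
    have : IsIso f.1 := hf
    exact ⟨⟨inv f.1, (hK.of_isIso (inv f.1) X.property).2⟩,
      Subtype.ext (IsIso.hom_inv_id f.1), Subtype.ext (IsIso.inv_hom_id f.1)⟩

/-- In a subcategory closed under limits and isomorphisms, a morphism of the subcategory that
factors through a monomorphism of the subcategory does so in the subcategory. -/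
theorem ClosedUnderElementary.mor_of_comp (hK : K.ClosedUnderElementary κ)
    (hlim : K.ClosedUnderLimits) {W X Y : K.Obj} (m : X ⟶ Y) [Mono m.1] (h : W.val ⟶ X.val)
    (hm : K.mor (h ≫ m.1)) : K.mor h := by
  have := hlim.1
  have := hlim.2
  have : HasLimitsOfSize.{0, 0} K.Obj := hasLimitsOfSizeShrink.{0, 0, w, w} K.Obj
  have : PreservesLimitsOfSize.{0, 0} K.incl := preservesLimitsOfSize_shrink.{0, w, 0, w} K.incl
  let f : W ⟶ Y := ⟨h ≫ m.1, hm⟩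
  -- The inclusion preserves this pullback. Its first projection is a monomorphism split by `l`, so
  -- `l` is invertible and lies in `K` by repleteness; `h` is `l` followed by the second projection.
  have sq : IsPullback (pullback.fst f m).1 (pullback.snd f m).1 (h ≫ m.1) m.1 :=
    (IsPullback.of_hasPullback f m).map K.incl
  have : Mono (pullback.fst f m).1 := sq.mono_fst_of_mono
  let l : W.val ⟶ (pullback f m).val := sq.lift (𝟙 _) h (by simp)
  have hl : l ≫ (pullback.fst f m).1 = 𝟙 _ := sq.lift_fst _ _ _
  have hl' : (pullback.fst f m).1 ≫ l = 𝟙 _ := by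
    rw [← cancel_mono (pullback.fst f m).1, Category.assoc, hl]
    simp
  have : IsIso l := ⟨_, hl, hl'⟩
  rw [← show l ≫ (pullback.snd f m).1 = h from sq.lift_snd _ _ _]
  exact K.comp_mem _ _ (hK.of_isIso l (pullback f m).property).2 (pullback.snd f m).2

/-- A solution set at an object of `L`, consisting of monomorphisms along which morphisms of the
subcategory factor in the subcategory. -/
theorem ClosedUnderElementary.exists_solutionSet (hK : K.ClosedUnderElementary κ)
    (hlim : K.ClosedUnderLimits) (X : L) :
    ∃ (ι : Type w) (B : ι → K.Obj), ∀ (Z : K.Obj) (f : X ⟶ Z.val),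
      ∃ (i : ι) (g : X ⟶ (B i).val) (m : B i ⟶ Z), g ≫ m.1 = f ∧ Mono m.1 ∧
        ∀ (W : K.Obj) (h : W.val ⟶ (B i).val), K.mor (h ≫ m.1) → K.mor h := by
  obtain ⟨S, E, _, _, _, _, h⟩ := id hK
  obtain ⟨ι, B, hB⟩ := exists_elementary_factorization E κ X
  refine ⟨{i // K.obj (B i)}, fun i => ⟨B i.1, i.2⟩, fun Z f => ?_⟩
  obtain ⟨i, g, m, hgm, hm⟩ := hB Z.val f
  obtain ⟨hi, hmor⟩ := h m Z.property hm
  have : Mono m := by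
    have := hm.1
    exact E.mono_of_mono_map this
  exact ⟨⟨i, hi⟩, g, ⟨m, hmor⟩, hgm, this, fun W k hk =>
    hK.mor_of_comp hlim (X := ⟨B i, hi⟩) (Y := Z) ⟨m, hmor⟩ k hk⟩

theorem ClosedUnderElementary.isReflective (hK : K.ClosedUnderElementary κ)
    (hlim : K.ClosedUnderLimits) : K.IsReflective := by
  have := hlim.1
  have := hlim.2
  refine isRightAdjoint_of_preservesLimits_of_solutionSetCondition K.incl fun X => ?_
  obtain ⟨ι, B, hB⟩ := hK.exists_solutionSet hlim X
  refine ⟨Σ i, (X ⟶ (B i).val), fun p => B p.1, fun p => p.2, fun Z f => ?_⟩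
  obtain ⟨i, g, m, hgm, -⟩ := hB Z f
  exact ⟨⟨i, g⟩, m, hgm⟩

/-- Colimits are a left adjoint to the constant-diagram functor. A cocone in `K` is a morphism out
of the colimit formed in `L`; factoring it elementarily gives a cocone from a small set, with legs
in `K` by the last clause of `exists_solutionSet`. -/
theorem ClosedUnderElementary.hasColimits (hK : K.ClosedUnderElementary κ)
    (hlim : K.ClosedUnderLimits) : HasColimitsOfSize.{w, w} K.Obj where
  has_colimits_of_shape J _ := by
    have := hlim.1
    have : HasColimitsOfSize.{w, w} L := by
      obtain ⟨μ, _, _⟩ := IsLocallyPresentable.exists_cardinal.{w} L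
      infer_instance
    rw [hasColimitsOfShape_iff_isRightAdjoint_const]
    refine isRightAdjoint_of_preservesLimits_of_solutionSetCondition _ fun D => ?_
    let c := colimit.cocone (D ⋙ K.incl)
    obtain ⟨ι, B, hB⟩ := hK.exists_solutionSet hlim c.pt
    refine ⟨Σ i, (D ⟶ (Functor.const J).obj (B i)), fun p => B p.1, fun p => p.2, fun Z f => ?_⟩
    let s : Cocone (D ⋙ K.incl) :=
      { pt := Z.val
        ι := { app := fun j => (f.app j).1
               naturality := fun i j k => congrArg Subtype.val (f.naturality k) } }
    obtain ⟨i, g, m, hgm, hmono, hm⟩ := hB Z (colimit.desc _ s)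
    let q (j : J) : (D.obj j).val ⟶ c.pt := c.ι.app j
    have hq (j j' : J) (a : j ⟶ j') : (D.map a).1 ≫ q j' = q j := c.w a
    have hj (j : J) : (q j ≫ g) ≫ m.1 = (f.app j).1 := by
      rw [Category.assoc, hgm]
      exact colimit.ι_desc _ _
    let k (j : J) : D.obj j ⟶ B i :=
      ⟨q j ≫ g, hm (D.obj j) (q j ≫ g) ((hj j).symm ▸ (f.app j).2)⟩
    have hk (j j' : J) (a : j ⟶ j') : D.map a ≫ k j' = k j :=
      Subtype.ext ((Category.assoc _ _ _).symm.trans (congrArg (· ≫ g) (hq j j' a)))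
    refine ⟨⟨i, { app := k, naturality := fun j j' a => ?_ }⟩, m, ?_⟩
    · simpa using hk j j' a
    · ext j
      exact Subtype.ext (hj j)

/-- The left adjoint preserves `l`-presentability since the inclusion preserves `l`-filtered
colimits. It sends a strong generator to a strong generator since the inclusion is faithful and
reflects isomorphisms. -/
theorem ClosedUnderElementary.isCardinalLocallyPresentable (hK : K.ClosedUnderElementary κ)
    (hlim : K.ClosedUnderLimits) (l : Cardinal.{w}) [Fact l.IsRegular]
    [IsCardinalLocallyPresentable L l] (hl : K.ClosedUnderFilteredColimits l) :
    IsCardinalLocallyPresentable K.Obj l := by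
  have := hK.hasColimits hlim
  have := hK.reflectsIsomorphisms
  have := hl.2
  have : K.incl.IsRightAdjoint := hK.isReflective hlim
  let adj := Adjunction.ofIsRightAdjoint K.incl
  obtain ⟨P, _, hP, hP'⟩ :=
    (IsCardinalLocallyPresentable.iff_exists_isStrongGenerator L l).1 inferInstance
  rw [IsCardinalLocallyPresentable.iff_exists_isStrongGenerator]
  refine ⟨P.strictMap K.incl.leftAdjoint, inferInstance, ?_, ?_⟩
  · rw [ObjectProperty.isStrongGenerator_iff]
    constructor
    · intro X Y f g h
      apply K.incl.map_injective
      apply hP.isSeparating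
      intro G hG x
      have := h (K.incl.leftAdjoint.obj G) ⟨G, hG⟩ ((adj.homEquiv G X).symm x)
      apply (adj.homEquiv G Y).symm.injective
      simpa [adj.homEquiv_naturality_right_symm] using this
    · intro X Y i hi h
      have : IsIso (K.incl.map i) := by
        refine hP.isIso_of_mono _ fun G hG y => ?_
        obtain ⟨x, hx⟩ := h (K.incl.leftAdjoint.obj G) ⟨G, hG⟩ ((adj.homEquiv G Y).symm y)
        refine ⟨adj.homEquiv G X x, ?_⟩
        change adj.homEquiv G X x ≫ K.incl.map i = y
        rw [← adj.homEquiv_naturality_right]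
        exact (adj.homEquiv G Y).eq_symm_apply.1 hx
      exact isIso_of_reflects_iso i K.incl
  · rintro _ ⟨X, hX⟩
    have : IsCardinalPresentable X l := hP' X hX
    exact adj.isCardinalPresentable_leftAdjoint_obj l X

end Subcat

end ElemRefl

theorem theorem4p1 {L : Type u} [Category.{w} L] [IsLocallyPresentable.{w} L]
    (K : ElemRefl.Subcat L) (hlim : K.ClosedUnderLimits) :
    (∀ (l : Cardinal.{w}) [Fact l.IsRegular],
      K.ClosedUnderFilteredColimits l → K.ClosedUnderElementary l → K.IsReflective) ∧
    (∀ (l κ : Cardinal.{w}) [Fact l.IsRegular] [Fact κ.IsRegular],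
      IsCardinalLocallyPresentable L l → l ≤ κ →
      K.ClosedUnderFilteredColimits l → K.ClosedUnderElementary κ →
      K.IsReflective ∧ IsCardinalLocallyPresentable K.Obj l) :=
  ⟨fun _ _ _ hK => hK.isReflective hlim,
    fun l _ _ _ _ _ hl hK =>
      ⟨hK.isReflective hlim, hK.isCardinalLocallyPresentable hlim l hl⟩⟩
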